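/- Let $n \geq 3$ and let $(M,g)$ be a closed Riemannian manifold of dimension $n$, that is, $M$ is a non-empty compact Hausdorff smooth manifold without boundary and $g$ is a smooth Riemannian metric on $M$. Let $S_g$ denote the scalar curvature of $g$ (normalized so that the round unit sphere has scalar curvature $n(n-1)$), and suppose that $S_g(x) \leq 0$ for every $x \in M$. Then there exist a function $H' \in C^\infty(M)$ with $H'(x_0) > 0$ for some $x_0 \in M$, and a smooth Riemannian metric $\tilde g = e^{2f} g$ with $f \in C^\infty(M)$ (a conformal change of $g$), such that the scalar curvature of $\tilde g$ satisfies $S_{\tilde g} = H'$ everywhere on $M$. -/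

import Mathlib

open Bundle Manifold
open scoped ContDiff

noncomputable section

namespace RiemannianScalar

/-- Smooth Riemannian metrics on the tangent bundle of an `n`-manifold `M`. -/
abbrev Metric (n : ℕ) (M : Type*) [TopologicalSpace M]
    [ChartedSpace (EuclideanSpace ℝ (Fin n)) M] [IsManifold (𝓡 n) ∞ M] :=
  ContMDiffRiemannianMetric (𝓡 n) ∞ (EuclideanSpace ℝ (Fin n))
    (fun x : M => TangentSpace (𝓡 n) x)

section Coordinates

variable {n : ℕ}

/-- The partial derivative `∂ᵢ f (y)` of a real function on `ℝⁿ`. -/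
def partialDeriv (i : Fin n) (f : EuclideanSpace ℝ (Fin n) → ℝ)
    (y : EuclideanSpace ℝ (Fin n)) : ℝ :=
  fderiv ℝ f y (EuclideanSpace.single i 1)

/-- The Christoffel symbols of the Levi-Civita connection of the metric with components `G i j`:
`Γᵏᵢⱼ = ½ ∑ₗ Gᵏˡ (∂ᵢ Gⱼₗ + ∂ⱼ Gᵢₗ - ∂ₗ Gᵢⱼ)`. -/
def christoffel (G : EuclideanSpace ℝ (Fin n) → Matrix (Fin n) (Fin n) ℝ)
    (k i j : Fin n) (y : EuclideanSpace ℝ (Fin n)) : ℝ :=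
  (1 / 2) * ∑ l, (G y)⁻¹ k l *
    (partialDeriv i (fun z => G z j l) y + partialDeriv j (fun z => G z i l) y
      - partialDeriv l (fun z => G z i j) y)

/-- The Ricci curvature in coordinates:
`Ricⱼₖ = ∑ᵢ (∂ᵢ Γⁱⱼₖ - ∂ⱼ Γⁱᵢₖ) + ∑ᵢ ∑ₘ (Γⁱᵢₘ Γᵐⱼₖ - Γⁱⱼₘ Γᵐᵢₖ)`. -/
def ricciCoord (G : EuclideanSpace ℝ (Fin n) → Matrix (Fin n) (Fin n) ℝ)
    (j k : Fin n) (y : EuclideanSpace ℝ (Fin n)) : ℝ :=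
  (∑ i, (partialDeriv i (christoffel G i j k) y - partialDeriv j (christoffel G i i k) y))
    + ∑ i, ∑ m, (christoffel G i i m y * christoffel G m j k y
      - christoffel G i j m y * christoffel G m i k y)

/-- The scalar curvature in coordinates: `S = ∑ⱼ ∑ₖ Gʲᵏ Ricⱼₖ`. -/
def scalarCoord (G : EuclideanSpace ℝ (Fin n) → Matrix (Fin n) (Fin n) ℝ)
    (y : EuclideanSpace ℝ (Fin n)) : ℝ :=
  ∑ j, ∑ k, (G y)⁻¹ j k * ricciCoord G j k y

end Coordinates

section Manifold

variable {n : ℕ} {M : Type*} [TopologicalSpace M]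
  [ChartedSpace (EuclideanSpace ℝ (Fin n)) M] [IsManifold (𝓡 n) ∞ M]

/-- The `i`-th coordinate vector field of the chart `e`, at the point with coordinates `y`. -/
def coordVector (e : OpenPartialHomeomorph M (EuclideanSpace ℝ (Fin n))) (i : Fin n)
    (y : EuclideanSpace ℝ (Fin n)) : TangentSpace (𝓡 n) (e.symm y) :=
  mfderiv (𝓡 n) (𝓡 n) e.symm y
    (EuclideanSpace.single i (1 : ℝ) : EuclideanSpace ℝ (Fin n))

/-- The components `gᵢⱼ = g(∂ᵢ, ∂ⱼ)` of `g` in the chart `e`. -/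
def metricCoord (g : Metric n M) (e : OpenPartialHomeomorph M (EuclideanSpace ℝ (Fin n)))
    (y : EuclideanSpace ℝ (Fin n)) : Matrix (Fin n) (Fin n) ℝ :=
  Matrix.of fun i j => g.inner (e.symm y) (coordVector e i y) (coordVector e j y)

/-- The scalar curvature `S_g` of a Riemannian metric. As the scalar curvature does not depend on
the choice of coordinates, its value at `x` is computed in the preferred chart around `x`. -/
def scalarCurvature (g : Metric n M) (x : M) : ℝ :=
  scalarCoord (metricCoord g (chartAt (EuclideanSpace ℝ (Fin n)) x))
    (chartAt (EuclideanSpace ℝ (Fin n)) x x)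

/-- `g'` is a conformal change of `g`: `g' = e^{2f} g` for some smooth real function `f`. -/
def IsConformalChange (g g' : Metric n M) : Prop :=
  ∃ f : M → ℝ, ContMDiff (𝓡 n) 𝓘(ℝ, ℝ) ∞ f ∧
    ∀ (x : M) (v w : TangentSpace (𝓡 n) x),
      g'.inner x v w = Real.exp (2 * f x) * g.inner x v w

end Manifold

end RiemannianScalar

end

/-!
The scalar curvature at a chosen point `x` is made positive by a conformal factor concentrated
near `x`, and `H'` is then the scalar curvature of the new metric. Let `c` be the preferred chart
around `x`, and let `f = a ‖c - c x‖²` near `x`, cut off by a bump function. At the critical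
point `x` of `f`, where moreover `f x = 0`, the conformal change `g' = e^{2f} g` satisfies
`S_{g'}(x) = S_g(x) - 2 (n - 1) tr_g (D² f)(x)`
(`IsMetricOn.scalar_conformal`). Here `D² f = 2 a ⟨·, ·⟩`, and the `g`-trace of the Euclidean inner
product is positive (`trace_inverse_inner_pos`), so a suitable `a` gives `S_{g'}(x) = 1`.

The other half is the smoothness of `S_{g'}` (`contMDiff_scalarCurvature`). Its value at each point
is defined through the preferred chart around that point, so smoothness rests on the invariance of
the scalar curvature under changes of charts. This is proved for smooth metrics on open sets of a
normed space `E`, regarded as fields `B` of bilinear forms: the Christoffel symbols become a field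
`connection B` of bilinear maps `E × E → E`, the curvature is an endomorphism-valued form, and Ricci
and scalar curvature are traces. Differentiating `φ^* B = C` gives the transformation law
`Dφ (Γ_C(u, v)) = Γ_B(Dφ u, Dφ v) + D²φ(u, v)` (`IsLocalIsometryOn.fderiv_connection`).
Differentiating once more, the symmetry of `D²φ` and `D³φ` makes the curvature natural
(`IsLocalIsometryOn.fderiv_curvature`), and conjugation invariance of the trace finishes the
argument. The link to the index formulas is `IsMetricOn.scalarCoord_eq`.
-/

noncomputable section

namespace RiemannianScalar

open Topology Set Filter
open scoped Matrix

-- Instances on iterated spaces of continuous linear maps need nested instance problems.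
set_option maxSynthPendingDepth 3

/-! ### Christoffel symbols and curvature of a field of bilinear forms -/

theorem minSmoothness_two_le_infty : minSmoothness ℝ 2 ≤ (∞ : WithTop ℕ∞) := by
  rw [minSmoothness_of_isRCLikeNormedField]
  exact WithTop.coe_le_coe.2 (le_top : (2 : ℕ∞) ≤ ⊤)

section Local

variable {E : Type*} [NormedAddCommGroup E] [NormedSpace ℝ E]

/-- A field `B` of bilinear forms is a smooth Riemannian metric on the open set `U`. -/
structure IsMetricOn (B : E → E →L[ℝ] E →L[ℝ] ℝ) (U : Set E) : Prop where
  isOpen : IsOpen U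
  contDiffOn : ContDiffOn ℝ ∞ B U
  symm : ∀ y ∈ U, ∀ u v, B y u v = B y v u
  pos : ∀ y ∈ U, ∀ u, u ≠ 0 → 0 < B y u u

/-- The Christoffel symbols of the first kind, as a trilinear map:
`(u, v, w) ↦ ½ (D_u B (v, w) + D_v B (u, w) - D_w B (u, v))`. -/
def koszul (B : E → E →L[ℝ] E →L[ℝ] ℝ) (y : E) : E →L[ℝ] E →L[ℝ] E →L[ℝ] ℝ :=
  (1 / 2 : ℝ) • (fderiv ℝ B y + (fderiv ℝ B y).flip
    - ((ContinuousLinearMap.flipₗᵢ ℝ E E ℝ).toContinuousLinearEquiv :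
        (E →L[ℝ] E →L[ℝ] ℝ) →L[ℝ] (E →L[ℝ] E →L[ℝ] ℝ)) ∘L (fderiv ℝ B y).flip)

theorem koszul_apply (B : E → E →L[ℝ] E →L[ℝ] ℝ) (y u v w : E) :
    koszul B y u v w =
      1 / 2 * (fderiv ℝ B y u v w + fderiv ℝ B y v u w - fderiv ℝ B y w u v) := by
  simp [koszul]

/-- The Christoffel symbols `Γ(u, v)` of the second kind, as a field of bilinear maps: the vector
which `B` pairs with `w` to `koszul B y u v w`. The inverse is junk where `B y` is degenerate. -/
def connection (B : E → E →L[ℝ] E →L[ℝ] ℝ) (y : E) : E →L[ℝ] E →L[ℝ] E :=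
  (ContinuousLinearMap.compL ℝ E (E →L[ℝ] ℝ) E (B y).inverse) ∘L koszul B y

theorem connection_apply (B : E → E →L[ℝ] E →L[ℝ] ℝ) (y u v : E) :
    connection B y u v = (B y).inverse (koszul B y u v) := rfl

/-- The curvature `R(u, v) w` of the connection of `B`, as an endomorphism in `u` for fixed `v` and
`w`, so that its trace is the Ricci curvature. -/
def curvature (B : E → E →L[ℝ] E →L[ℝ] ℝ) (y v w : E) : E →ₗ[ℝ] E where
  toFun u := fderiv ℝ (connection B) y u v w - fderiv ℝ (connection B) y v u w
    + connection B y u (connection B y v w) - connection B y v (connection B y u w)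
  map_add' a b := by simp only [map_add, add_apply]; abel
  map_smul' c a := by
    simp only [map_smul, smul_apply, RingHom.id_apply]; module

theorem curvature_apply (B : E → E →L[ℝ] E →L[ℝ] ℝ) (y u v w : E) :
    curvature B y v w u =
      fderiv ℝ (connection B) y u v w - fderiv ℝ (connection B) y v u w
        + connection B y u (connection B y v w) - connection B y v (connection B y u w) := rfl

/-- The Ricci curvature `Ric(v, w) = tr (u ↦ R(u, v) w)`. -/
def ricci (B : E → E →L[ℝ] E →L[ℝ] ℝ) (y : E) : E →ₗ[ℝ] E →ₗ[ℝ] ℝ :=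
  LinearMap.mk₂ ℝ (fun v w => LinearMap.trace ℝ E (curvature B y v w))
    (fun a b w => by
      rw [← map_add]; congr 1; ext u
      simp only [curvature_apply, LinearMap.add_apply, map_add, add_apply]
      abel)
    (fun c a w => by
      rw [← map_smul]; congr 1; ext u
      simp only [curvature_apply, LinearMap.smul_apply, map_smul, smul_apply]
      module)
    (fun v a b => by
      rw [← map_add]; congr 1; ext u
      simp only [curvature_apply, LinearMap.add_apply, map_add]
      abel)
    (fun c v a => by
      rw [← map_smul]; congr 1; ext u
      simp only [curvature_apply, LinearMap.smul_apply, map_smul]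
      module)

theorem ricci_apply (B : E → E →L[ℝ] E →L[ℝ] ℝ) (y v w : E) :
    ricci B y v w = LinearMap.trace ℝ E (curvature B y v w) := rfl

variable [FiniteDimensional ℝ E]

/-- The endomorphism `A` representing a bilinear form `T` with respect to `B y`, that is,
`B y (A v) w = T v w`. -/
def raise (B : E → E →L[ℝ] E →L[ℝ] ℝ) (y : E) (T : E →ₗ[ℝ] E →ₗ[ℝ] ℝ) : E →ₗ[ℝ] E :=
  (B y).inverse.toLinearMap ∘ₗ LinearMap.toContinuousLinearMap.toLinearMap ∘ₗ T

/-- The scalar curvature of `B`: the trace of the Ricci curvature with respect to `B`. -/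
def scalar (B : E → E →L[ℝ] E →L[ℝ] ℝ) (y : E) : ℝ :=
  LinearMap.trace ℝ E (raise B y (ricci B y))

theorem isInvertible_of_pos {b : E →L[ℝ] E →L[ℝ] ℝ} (h : ∀ u, u ≠ 0 → 0 < b u u) :
    b.IsInvertible := by
  have hinj : Function.Injective b.toLinearMap := by
    rw [← LinearMap.ker_eq_bot, LinearMap.ker_eq_bot']
    intro u hu
    by_contra hne
    have := h u hne
    have h0 : b u = 0 := hu
    simp [h0] at this
  have hdim : Module.finrank ℝ E = Module.finrank ℝ (E →L[ℝ] ℝ) := by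
    rw [← (LinearMap.toContinuousLinearMap (𝕜 := ℝ) (E := E) (F' := ℝ)).finrank_eq]
    exact (Subspace.dual_finrank_eq (K := ℝ) (V := E)).symm
  refine ⟨(LinearEquiv.ofInjectiveOfFinrankEq b.toLinearMap hinj hdim).toContinuousLinearEquiv, ?_⟩
  ext u v
  rfl

namespace IsMetricOn

variable {B : E → E →L[ℝ] E →L[ℝ] ℝ} {U : Set E} {y : E}

theorem isInvertible (h : IsMetricOn B U) (hy : y ∈ U) : (B y).IsInvertible :=
  isInvertible_of_pos (h.pos y hy)

theorem ext_left (h : IsMetricOn B U) (hy : y ∈ U) {u v : E} (huv : ∀ w, B y u w = B y v w) :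
    u = v :=
  (h.isInvertible hy).injective (ContinuousLinearMap.ext huv)

omit [FiniteDimensional ℝ E] in
theorem contDiffOn_fderiv (h : IsMetricOn B U) : ContDiffOn ℝ ∞ (fderiv ℝ B) U :=
  h.contDiffOn.fderiv_of_isOpen h.isOpen (by simp)

theorem contDiffOn_inverse (h : IsMetricOn B U) :
    ContDiffOn ℝ ∞ (fun z => (B z).inverse) U := by
  have : CompleteSpace E := FiniteDimensional.complete ℝ E
  exact fun z hz => ((h.isInvertible hz).contDiffAt_map_inverse).comp_contDiffWithinAt z
    (h.contDiffOn z hz)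

theorem contDiffOn_connection (h : IsMetricOn B U) : ContDiffOn ℝ ∞ (connection B) U := by
  refine contDiffOn_clm_apply.2 fun u => contDiffOn_clm_apply.2 fun v => ?_
  refine h.contDiffOn_inverse.clm_apply (contDiffOn_clm_apply.2 fun w => ?_)
  change ContDiffOn ℝ ∞ (fun z => koszul B z u v w) U
  simp only [koszul_apply]
  have hD : ∀ a b c : E, ContDiffOn ℝ ∞ (fun z => fderiv ℝ B z a b c) U := fun a b c =>
    ((h.contDiffOn_fderiv.clm_apply contDiffOn_const).clm_apply contDiffOn_const).clm_apply
      contDiffOn_const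
  exact contDiffOn_const.mul (((hD u v w).add (hD v u w)).sub (hD w u v))

theorem contDiffOn_fderiv_connection (h : IsMetricOn B U) :
    ContDiffOn ℝ ∞ (fderiv ℝ (connection B)) U :=
  h.contDiffOn_connection.fderiv_of_isOpen h.isOpen (by simp)

omit [FiniteDimensional ℝ E] in
theorem differentiableAt (h : IsMetricOn B U) (hy : y ∈ U) : DifferentiableAt ℝ B y :=
  (h.contDiffOn.contDiffAt (h.isOpen.mem_nhds hy)).differentiableAt (by simp)

theorem differentiableAt_connection (h : IsMetricOn B U) (hy : y ∈ U) :
    DifferentiableAt ℝ (connection B) y :=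
  (h.contDiffOn_connection.contDiffAt (h.isOpen.mem_nhds hy)).differentiableAt (by simp)

theorem apply_connection (h : IsMetricOn B U) (hy : y ∈ U) (u v w : E) :
    B y (connection B y u v) w =
      1 / 2 * (fderiv ℝ B y u v w + fderiv ℝ B y v u w - fderiv ℝ B y w u v) := by
  rw [connection_apply, (h.isInvertible hy).self_apply_inverse, koszul_apply]

end IsMetricOn

theorem apply_raise {B : E → E →L[ℝ] E →L[ℝ] ℝ} {y : E} (h : (B y).IsInvertible)
    (T : E →ₗ[ℝ] E →ₗ[ℝ] ℝ) (v w : E) : B y (raise B y T v) w = T v w := by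
  simp [raise, h.self_apply_inverse]

end Local

/-! ### Invariance under local isometries -/

section Local

variable {E : Type*} [NormedAddCommGroup E] [NormedSpace ℝ E]

/-- The map `φ` is a smooth local isometry from the Riemannian metric `C` on `V` to the Riemannian
metric `B` on `U`. -/
structure IsLocalIsometryOn (φ : E → E) (C : E → E →L[ℝ] E →L[ℝ] ℝ) (V : Set E)
    (B : E → E →L[ℝ] E →L[ℝ] ℝ) (U : Set E) : Prop where
  source : IsMetricOn C V
  target : IsMetricOn B U
  contDiffOn : ContDiffOn ℝ ∞ φ V
  mapsTo : MapsTo φ V U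
  pullback : ∀ y ∈ V, ∀ u v, C y u v = B (φ y) (fderiv ℝ φ y u) (fderiv ℝ φ y v)

namespace IsLocalIsometryOn

variable {φ : E → E} {B C : E → E →L[ℝ] E →L[ℝ] ℝ} {U V : Set E} {y : E}

theorem contDiffOn_fderiv (h : IsLocalIsometryOn φ C V B U) :
    ContDiffOn ℝ ∞ (fderiv ℝ φ) V :=
  h.contDiffOn.fderiv_of_isOpen h.source.isOpen (by simp)

theorem contDiffOn_fderiv_fderiv (h : IsLocalIsometryOn φ C V B U) :
    ContDiffOn ℝ ∞ (fderiv ℝ (fderiv ℝ φ)) V :=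
  h.contDiffOn_fderiv.fderiv_of_isOpen h.source.isOpen (by simp)

theorem hasFDerivAt (h : IsLocalIsometryOn φ C V B U) (hy : y ∈ V) :
    HasFDerivAt φ (fderiv ℝ φ y) y :=
  ((h.contDiffOn.contDiffAt (h.source.isOpen.mem_nhds hy)).differentiableAt
    (by simp)).hasFDerivAt

theorem hasFDerivAt_fderiv (h : IsLocalIsometryOn φ C V B U) (hy : y ∈ V) :
    HasFDerivAt (fderiv ℝ φ) (fderiv ℝ (fderiv ℝ φ) y) y :=
  ((h.contDiffOn_fderiv.contDiffAt (h.source.isOpen.mem_nhds hy)).differentiableAt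
    (by simp)).hasFDerivAt

theorem hasFDerivAt_fderiv_fderiv (h : IsLocalIsometryOn φ C V B U) (hy : y ∈ V) :
    HasFDerivAt (fderiv ℝ (fderiv ℝ φ)) (fderiv ℝ (fderiv ℝ (fderiv ℝ φ)) y) y :=
  ((h.contDiffOn_fderiv_fderiv.contDiffAt (h.source.isOpen.mem_nhds hy)).differentiableAt
    (by simp)).hasFDerivAt

theorem fderiv_fderiv_symm (h : IsLocalIsometryOn φ C V B U) (hy : y ∈ V) (u v : E) :
    fderiv ℝ (fderiv ℝ φ) y u v = fderiv ℝ (fderiv ℝ φ) y v u :=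
  (h.contDiffOn.contDiffAt (h.source.isOpen.mem_nhds hy)).isSymmSndFDerivAt
    minSmoothness_two_le_infty u v

theorem fderiv_fderiv_fderiv_symm (h : IsLocalIsometryOn φ C V B U) (hy : y ∈ V) (u v : E) :
    fderiv ℝ (fderiv ℝ (fderiv ℝ φ)) y u v = fderiv ℝ (fderiv ℝ (fderiv ℝ φ)) y v u :=
  (h.contDiffOn_fderiv.contDiffAt (h.source.isOpen.mem_nhds hy)).isSymmSndFDerivAt
    minSmoothness_two_le_infty u v

/-- A local isometry is an immersion, by positivity of the pulled back metric. -/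
theorem injective_fderiv (h : IsLocalIsometryOn φ C V B U) (hy : y ∈ V) :
    Function.Injective (fderiv ℝ φ y) := by
  rw [injective_iff_map_eq_zero]
  intro u hu
  by_contra hne
  have := h.source.pos y hy u hne
  simp [h.pullback y hy, hu] at this

theorem fderiv_pullback (h : IsLocalIsometryOn φ C V B U) (hy : y ∈ V) (w u v : E) :
    fderiv ℝ C y w u v =
      fderiv ℝ B (φ y) (fderiv ℝ φ y w) (fderiv ℝ φ y u) (fderiv ℝ φ y v)
        + B (φ y) (fderiv ℝ (fderiv ℝ φ) y w u) (fderiv ℝ φ y v)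
        + B (φ y) (fderiv ℝ φ y u) (fderiv ℝ (fderiv ℝ φ) y w v) := by
  have h1 := ((h.source.differentiableAt hy).hasFDerivAt.clm_apply
    (hasFDerivAt_const u y)).clm_apply (hasFDerivAt_const v y)
  have hB := (h.target.differentiableAt (h.mapsTo hy)).hasFDerivAt.comp y (h.hasFDerivAt hy)
  have h2 := (hB.clm_apply ((h.hasFDerivAt_fderiv hy).clm_apply (hasFDerivAt_const u y))).clm_apply
    ((h.hasFDerivAt_fderiv hy).clm_apply (hasFDerivAt_const v y))
  have h3 := h1.unique (h2.congr_of_eventuallyEq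
    (by filter_upwards [h.source.isOpen.mem_nhds hy] with z hz using h.pullback z hz u v))
  have h4 := DFunLike.congr_fun h3 w
  simp at h4
  rw [h4]
  ring

variable [FiniteDimensional ℝ E]

/-- The differential of a local isometry, as a linear equivalence. -/
def fderivEquiv (h : IsLocalIsometryOn φ C V B U) (hy : y ∈ V) : E ≃ₗ[ℝ] E :=
  LinearEquiv.ofInjectiveEndo (fderiv ℝ φ y).toLinearMap (h.injective_fderiv hy)

theorem fderivEquiv_apply (h : IsLocalIsometryOn φ C V B U) (hy : y ∈ V) (u : E) :
    h.fderivEquiv hy u = fderiv ℝ φ y u := rfl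

/-- The transformation law of the Christoffel symbols. -/
theorem fderiv_connection (h : IsLocalIsometryOn φ C V B U) (hy : y ∈ V) (u v : E) :
    fderiv ℝ φ y (connection C y u v) =
      connection B (φ y) (fderiv ℝ φ y u) (fderiv ℝ φ y v) + fderiv ℝ (fderiv ℝ φ) y u v := by
  refine h.target.ext_left (h.mapsTo hy) fun w' => ?_
  obtain ⟨w, rfl⟩ := (h.fderivEquiv hy).surjective w'
  rw [fderivEquiv_apply, ← h.pullback y hy, h.source.apply_connection hy, map_add, add_apply,
    h.target.apply_connection (h.mapsTo hy), h.fderiv_pullback hy, h.fderiv_pullback hy,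
    h.fderiv_pullback hy, h.fderiv_fderiv_symm hy v u, h.fderiv_fderiv_symm hy w u,
    h.fderiv_fderiv_symm hy w v,
    h.target.symm _ (h.mapsTo hy) (fderiv ℝ φ y v) (fderiv ℝ (fderiv ℝ φ) y u w)]
  ring

/-- The derivative of the transformation law `IsLocalIsometryOn.fderiv_connection`. -/
theorem fderiv_fderiv_connection (h : IsLocalIsometryOn φ C V B U) (hy : y ∈ V) (w u v : E) :
    fderiv ℝ φ y (fderiv ℝ (connection C) y w u v) =
      fderiv ℝ (connection B) (φ y) (fderiv ℝ φ y w) (fderiv ℝ φ y u) (fderiv ℝ φ y v)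
        + connection B (φ y) (fderiv ℝ (fderiv ℝ φ) y w u) (fderiv ℝ φ y v)
        + connection B (φ y) (fderiv ℝ φ y u) (fderiv ℝ (fderiv ℝ φ) y w v)
        + fderiv ℝ (fderiv ℝ (fderiv ℝ φ)) y w u v
        - fderiv ℝ (fderiv ℝ φ) y w (connection C y u v) := by
  have h1 := (h.hasFDerivAt_fderiv hy).clm_apply
    (((h.source.differentiableAt_connection hy).hasFDerivAt.clm_apply
    (hasFDerivAt_const u y)).clm_apply (hasFDerivAt_const v y))
  have hB := (h.target.differentiableAt_connection (h.mapsTo hy)).hasFDerivAt.comp y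
    (h.hasFDerivAt hy)
  have h2 := ((hB.clm_apply ((h.hasFDerivAt_fderiv hy).clm_apply
    (hasFDerivAt_const u y))).clm_apply
    ((h.hasFDerivAt_fderiv hy).clm_apply (hasFDerivAt_const v y))).add
    (((h.hasFDerivAt_fderiv_fderiv hy).clm_apply (hasFDerivAt_const u y)).clm_apply
      (hasFDerivAt_const v y))
  have h3 := h1.unique (h2.congr_of_eventuallyEq
    (by filter_upwards [h.source.isOpen.mem_nhds hy] with z hz using h.fderiv_connection hz u v))
  have h4 := DFunLike.congr_fun h3 w
  simp at h4
  rw [eq_sub_iff_add_eq, h4]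
  abel

/-- The curvature is natural under local isometries. -/
theorem fderiv_curvature (h : IsLocalIsometryOn φ C V B U) (hy : y ∈ V) (u v w : E) :
    fderiv ℝ φ y (curvature C y v w u) =
      curvature B (φ y) (fderiv ℝ φ y v) (fderiv ℝ φ y w) (fderiv ℝ φ y u) := by
  simp only [curvature_apply, map_sub, map_add, h.fderiv_fderiv_connection hy,
    h.fderiv_connection hy, h.fderiv_fderiv_symm hy v u,
    h.fderiv_fderiv_fderiv_symm hy v u]
  abel

theorem ricci_eq (h : IsLocalIsometryOn φ C V B U) (hy : y ∈ V) (v w : E) :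
    ricci C y v w = ricci B (φ y) (fderiv ℝ φ y v) (fderiv ℝ φ y w) := by
  rw [ricci_apply, ricci_apply, ← LinearMap.trace_conj' _ (h.fderivEquiv hy)]
  congr 1
  ext u
  obtain ⟨u, rfl⟩ := (h.fderivEquiv hy).surjective u
  rw [LinearEquiv.conj_apply_apply, LinearEquiv.symm_apply_apply, fderivEquiv_apply,
    fderivEquiv_apply, h.fderiv_curvature hy]

/-- The scalar curvature is invariant under local isometries. -/
theorem scalar_eq (h : IsLocalIsometryOn φ C V B U) (hy : y ∈ V) :
    scalar C y = scalar B (φ y) := by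
  rw [scalar, scalar, ← LinearMap.trace_conj' _ (h.fderivEquiv hy)]
  congr 1
  ext u
  obtain ⟨u, rfl⟩ := (h.fderivEquiv hy).surjective u
  rw [LinearEquiv.conj_apply_apply, LinearEquiv.symm_apply_apply]
  refine h.target.ext_left (h.mapsTo hy) fun w => ?_
  obtain ⟨w, rfl⟩ := (h.fderivEquiv hy).surjective w
  rw [apply_raise (h.target.isInvertible (h.mapsTo hy)), fderivEquiv_apply, fderivEquiv_apply,
    fderivEquiv_apply, ← h.pullback y hy, apply_raise (h.source.isInvertible hy), h.ricci_eq hy]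

end IsLocalIsometryOn

end Local

/-! ### Conformal metrics at a critical point of the conformal factor -/

section Local

variable {E : Type*} [NormedAddCommGroup E] [NormedSpace ℝ E]

/-- The gradient of `f` with respect to `B`. -/
def gradient (B : E → E →L[ℝ] E →L[ℝ] ℝ) (f : E → ℝ) (y : E) : E :=
  (B y).inverse (fderiv ℝ f y)

/-- The second derivative of `f`, raised to an endomorphism by `B`. It agrees with the covariant
Hessian at the critical points of `f` only, as the Christoffel symbols do not enter. -/
def hessian (B : E → E →L[ℝ] E →L[ℝ] ℝ) (f : E → ℝ) (y : E) : E →L[ℝ] E :=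
  (B y).inverse ∘L fderiv ℝ (fderiv ℝ f) y

namespace IsMetricOn

variable {B C : E → E →L[ℝ] E →L[ℝ] ℝ} {U : Set E} {f : E → ℝ} {y : E}

theorem conformal (h : IsMetricOn B U) (hf : ContDiffOn ℝ ∞ f U)
    (hC : ∀ y ∈ U, C y = Real.exp (2 * f y) • B y) : IsMetricOn C U where
  isOpen := h.isOpen
  contDiffOn := ((contDiffOn_const.mul hf).exp.smul h.contDiffOn).congr hC
  symm y hy u v := by simp [hC y hy, h.symm y hy u v]
  pos y hy u hu := by
    simpa [hC y hy] using mul_pos (Real.exp_pos _) (h.pos y hy u hu)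

variable [FiniteDimensional ℝ E]

theorem apply_gradient (h : IsMetricOn B U) (hy : y ∈ U) (f : E → ℝ) (v : E) :
    B y (gradient B f y) v = fderiv ℝ f y v := by
  rw [gradient, (h.isInvertible hy).self_apply_inverse]

theorem apply_hessian (h : IsMetricOn B U) (hy : y ∈ U) (f : E → ℝ) (v w : E) :
    B y (hessian B f y v) w = fderiv ℝ (fderiv ℝ f) y v w := by
  rw [hessian, ContinuousLinearMap.comp_apply, (h.isInvertible hy).self_apply_inverse]

/-- The Christoffel symbols of a conformal metric `e^{2f} B`. -/
theorem connection_conformal (h : IsMetricOn B U) (hf : ContDiffOn ℝ ∞ f U)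
    (hC : ∀ y ∈ U, C y = Real.exp (2 * f y) • B y) (hy : y ∈ U) (u v : E) :
    connection C y u v = connection B y u v + fderiv ℝ f y u • v + fderiv ℝ f y v • u
      - B y u v • gradient B f y := by
  have h' := h.conformal hf hC
  have hD : ∀ a b c, fderiv ℝ C y a b c =
      Real.exp (2 * f y) * (2 * fderiv ℝ f y a * B y b c + fderiv ℝ B y a b c) := by
    intro a b c
    have hfd := ((hf.contDiffAt (h.isOpen.mem_nhds hy)).differentiableAt (by simp)).hasFDerivAt
    have h1 := ((hfd.const_mul 2).exp.smul
      (h.differentiableAt hy).hasFDerivAt).congr_of_eventuallyEq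
      (by filter_upwards [h.isOpen.mem_nhds hy] with z hz using hC z hz)
    rw [h1.fderiv]
    simp
    ring
  refine h'.ext_left hy fun w => ?_
  rw [h'.apply_connection hy, hD, hD, hD, hC y hy]
  simp only [smul_apply, map_add, map_sub, add_apply, sub_apply, map_smul,
    h.apply_connection hy, h.apply_gradient hy, smul_eq_mul]
  rw [h.symm y hy v w, h.symm y hy u w]
  ring

theorem hasFDerivAt_gradient (h : IsMetricOn B U) (hf : ContDiffOn ℝ ∞ f U) (hy : y ∈ U)
    (hcrit : fderiv ℝ f y = 0) : HasFDerivAt (gradient B f) (hessian B f y) y := by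
  have hI := ((h.contDiffOn_inverse.contDiffAt (h.isOpen.mem_nhds hy)).differentiableAt
    (by simp)).hasFDerivAt
  have hdf := (((hf.fderiv_of_isOpen h.isOpen (m := ∞) (by simp)).contDiffAt
    (h.isOpen.mem_nhds hy)).differentiableAt (by simp)).hasFDerivAt
  convert! hI.clm_apply hdf using 1
  ext v
  simp [hessian, hcrit]

/-- The derivative of the Christoffel symbols of `e^{2f} B` at a critical point of `f`. -/
theorem fderiv_connection_conformal (h : IsMetricOn B U) (hf : ContDiffOn ℝ ∞ f U)
    (hC : ∀ y ∈ U, C y = Real.exp (2 * f y) • B y) (hy : y ∈ U) (hcrit : fderiv ℝ f y = 0)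
    (w u v : E) :
    fderiv ℝ (connection C) y w u v = fderiv ℝ (connection B) y w u v
      + fderiv ℝ (fderiv ℝ f) y w u • v + fderiv ℝ (fderiv ℝ f) y w v • u
      - B y u v • hessian B f y w := by
  have h' := h.conformal hf hC
  have hdf := (((hf.fderiv_of_isOpen h.isOpen (m := ∞) (by simp)).contDiffAt
    (h.isOpen.mem_nhds hy)).differentiableAt (by simp)).hasFDerivAt
  have h1 := ((h'.differentiableAt_connection hy).hasFDerivAt.clm_apply
    (hasFDerivAt_const u y)).clm_apply (hasFDerivAt_const v y)
  have h2 := ((h.differentiableAt_connection hy).hasFDerivAt.clm_apply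
    (hasFDerivAt_const u y)).clm_apply (hasFDerivAt_const v y)
  have hBd := ((h.differentiableAt hy).hasFDerivAt.clm_apply
    (hasFDerivAt_const u y)).clm_apply (hasFDerivAt_const v y)
  have h3 := ((h2.add ((hdf.clm_apply (hasFDerivAt_const u y)).smul_const v)).add
    ((hdf.clm_apply (hasFDerivAt_const v y)).smul_const u)).sub
    (hBd.smul (h.hasFDerivAt_gradient hf hy hcrit))
  have h4 := h1.unique (h3.congr_of_eventuallyEq (by
    filter_upwards [h.isOpen.mem_nhds hy] with z hz using h.connection_conformal hf hC hz u v))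
  have h5 := DFunLike.congr_fun h4 w
  have hgrad : gradient B f y = 0 := by simp [gradient, hcrit]
  simpa [hgrad] using h5

theorem curvature_conformal (h : IsMetricOn B U) (hf : ContDiffOn ℝ ∞ f U)
    (hC : ∀ y ∈ U, C y = Real.exp (2 * f y) • B y) (hy : y ∈ U) (hcrit : fderiv ℝ f y = 0)
    (v w : E) :
    curvature C y v w = curvature B y v w
      + ((fderiv ℝ (fderiv ℝ f) y w).toLinearMap.smulRight v
        - fderiv ℝ (fderiv ℝ f) y v w • LinearMap.id - B y v w • (hessian B f y).toLinearMap
        + (B y w).toLinearMap.smulRight (hessian B f y v)) := by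
  have hgrad : gradient B f y = 0 := by simp [gradient, hcrit]
  have hsymm : ∀ a b, fderiv ℝ (fderiv ℝ f) y a b = fderiv ℝ (fderiv ℝ f) y b a :=
    (hf.contDiffAt (h.isOpen.mem_nhds hy)).isSymmSndFDerivAt
      minSmoothness_two_le_infty
  ext u
  simp only [curvature_apply, h.fderiv_connection_conformal hf hC hy hcrit,
    h.connection_conformal hf hC hy, hcrit, hgrad]
  simp only [LinearMap.add_apply, LinearMap.sub_apply, LinearMap.smul_apply,
    LinearMap.smulRight_apply, ContinuousLinearMap.coe_coe, curvature_apply, zero_apply, zero_smul,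
    smul_zero, LinearMap.id_apply, sub_zero, add_zero]
  rw [hsymm w u, hsymm v u, h.symm y hy w u]
  module

theorem ricci_conformal (h : IsMetricOn B U) (hf : ContDiffOn ℝ ∞ f U)
    (hC : ∀ y ∈ U, C y = Real.exp (2 * f y) • B y) (hy : y ∈ U) (hcrit : fderiv ℝ f y = 0)
    (v w : E) :
    ricci C y v w = ricci B y v w
      + (2 - Module.finrank ℝ E) * fderiv ℝ (fderiv ℝ f) y v w
      - LinearMap.trace ℝ E (hessian B f y).toLinearMap * B y v w := by
  have hsymm : fderiv ℝ (fderiv ℝ f) y w v = fderiv ℝ (fderiv ℝ f) y v w :=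
    (hf.contDiffAt (h.isOpen.mem_nhds hy)).isSymmSndFDerivAt
      minSmoothness_two_le_infty w v
  rw [ricci_apply, ricci_apply, h.curvature_conformal hf hC hy hcrit]
  simp only [map_add, map_sub, map_smul, LinearMap.trace_smulRight, LinearMap.trace_id,
    ContinuousLinearMap.coe_coe, smul_eq_mul]
  rw [h.symm y hy w, h.apply_hessian hy, hsymm]
  ring

/-- The scalar curvature of `e^{2f} B` at a critical point of `f`, up to the factor `e^{2f}`. -/
theorem scalar_conformal (h : IsMetricOn B U) (hf : ContDiffOn ℝ ∞ f U)
    (hC : ∀ y ∈ U, C y = Real.exp (2 * f y) • B y) (hy : y ∈ U) (hcrit : fderiv ℝ f y = 0) :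
    Real.exp (2 * f y) * scalar C y = scalar B y
      - 2 * (Module.finrank ℝ E - 1) * LinearMap.trace ℝ E (hessian B f y).toLinearMap := by
  have h' := h.conformal hf hC
  -- Raising an index with `e^{2f} B` instead of `B` costs the factor `e^{-2f}`.
  have key : Real.exp (2 * f y) • raise C y (ricci C y) = raise B y (ricci B y)
      + (2 - Module.finrank ℝ E : ℝ) • (hessian B f y).toLinearMap
      - LinearMap.trace ℝ E (hessian B f y).toLinearMap • LinearMap.id := by
    ext v
    refine h.ext_left hy fun w => ?_
    have h1 := apply_raise (h'.isInvertible hy) (ricci C y) v w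
    rw [h.ricci_conformal hf hC hy hcrit, hC y hy] at h1
    simp only [LinearMap.smul_apply, LinearMap.add_apply, LinearMap.sub_apply, map_smul, map_add,
      map_sub, smul_apply, add_apply, sub_apply, LinearMap.id_apply, smul_eq_mul,
      ContinuousLinearMap.coe_coe, apply_raise (h.isInvertible hy), h.apply_hessian hy] at h1 ⊢
    exact h1
  have := congrArg (LinearMap.trace ℝ E) key
  simp only [map_add, map_sub, map_smul, LinearMap.trace_id, smul_eq_mul] at this
  rw [scalar, scalar, this]
  ring

end IsMetricOn

end Local

section Euclidean

variable {E : Type*} [NormedAddCommGroup E] [InnerProductSpace ℝ E] [FiniteDimensional ℝ E]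

/-- The trace of the Euclidean inner product with respect to any scalar product is positive. -/
theorem trace_inverse_inner_pos [Nontrivial E] {b : E →L[ℝ] E →L[ℝ] ℝ}
    (h : ∀ u, u ≠ 0 → 0 < b u u) :
    0 < LinearMap.trace ℝ E (b.inverse ∘L innerSL ℝ).toLinearMap := by
  have hb := isInvertible_of_pos h
  rw [LinearMap.trace_eq_sum_inner _ (stdOrthonormalBasis ℝ E)]
  have : Nonempty (Fin (Module.finrank ℝ E)) := ⟨⟨0, Module.finrank_pos⟩⟩
  refine Finset.sum_pos (fun i _ => ?_) Finset.univ_nonempty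
  set e := stdOrthonormalBasis ℝ E i
  have hx : b (b.inverse (innerSL ℝ e)) = innerSL ℝ e := hb.self_apply_inverse _
  have h1 : inner ℝ e (b.inverse (innerSL ℝ e)) =
      b (b.inverse (innerSL ℝ e)) (b.inverse (innerSL ℝ e)) := by rw [hx]; rfl
  change 0 < inner ℝ e (b.inverse (innerSL ℝ e))
  rw [h1]
  refine h _ fun h0 => ?_
  have h2 : innerSL ℝ e e = 0 := by rw [← hx, h0]; simp
  have h3 : inner ℝ e e = (1 : ℝ) := by simp [e]
  rw [innerSL_apply_apply, h3] at h2
  exact one_ne_zero h2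

end Euclidean

/-! ### The coordinate formulas -/

section Euclidean

/-- The `i`-th standard basis vector of `ℝⁿ`. -/
abbrev basisVec {n : ℕ} (i : Fin n) : EuclideanSpace ℝ (Fin n) := EuclideanSpace.single i 1

theorem eq_sum_single {n : ℕ} (x : EuclideanSpace ℝ (Fin n)) :
    x = ∑ i, x i • basisVec i := by
  conv_lhs => rw [← (EuclideanSpace.basisFun (Fin n) ℝ).sum_repr x]
  simp

theorem trace_eq_sum_coord
    {n : ℕ} (T : EuclideanSpace ℝ (Fin n) →ₗ[ℝ] EuclideanSpace ℝ (Fin n)) :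
    LinearMap.trace ℝ _ T = ∑ i, T (basisVec i) i := by
  rw [LinearMap.trace_eq_sum_inner T (EuclideanSpace.basisFun (Fin n) ℝ)]
  simp [EuclideanSpace.inner_single_left]

namespace IsMetricOn

section Smooth

variable {E : Type*} [NormedAddCommGroup E] [InnerProductSpace ℝ E] [FiniteDimensional ℝ E]
  {B : E → E →L[ℝ] E →L[ℝ] ℝ} {U : Set E}

theorem contDiffOn_ricci (h : IsMetricOn B U) (v w : E) :
    ContDiffOn ℝ ∞ (fun y => ricci B y v w) U := by
  simp only [ricci_apply, LinearMap.trace_eq_sum_inner _ (stdOrthonormalBasis ℝ E),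
    curvature_apply]
  have hD : ∀ a b c : E, ContDiffOn ℝ ∞ (fun z => fderiv ℝ (connection B) z a b c) U :=
    fun a b c => ((h.contDiffOn_fderiv_connection.clm_apply contDiffOn_const).clm_apply
      contDiffOn_const).clm_apply contDiffOn_const
  have hΓ : ∀ (a : E) {x : E → E}, ContDiffOn ℝ ∞ x U →
      ContDiffOn ℝ ∞ (fun z => connection B z a (x z)) U :=
    fun a x hx => (h.contDiffOn_connection.clm_apply contDiffOn_const).clm_apply hx
  exact ContDiffOn.sum fun i _ => contDiffOn_const.inner ℝ ((((hD _ _ _).sub (hD _ _ _)).add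
    (hΓ _ (hΓ _ contDiffOn_const))).sub (hΓ _ (hΓ _ contDiffOn_const)))

theorem contDiffOn_scalar (h : IsMetricOn B U) : ContDiffOn ℝ ∞ (scalar B) U := by
  unfold scalar
  simp only [LinearMap.trace_eq_sum_inner _ (stdOrthonormalBasis ℝ E)]
  refine ContDiffOn.sum fun i _ => contDiffOn_const.inner ℝ
    (h.contDiffOn_inverse.clm_apply (contDiffOn_clm_apply.2 fun w => ?_))
  exact h.contDiffOn_ricci _ w

end Smooth

variable {n : ℕ} {B : EuclideanSpace ℝ (Fin n) → EuclideanSpace ℝ (Fin n) →L[ℝ]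
    EuclideanSpace ℝ (Fin n) →L[ℝ] ℝ} {U : Set (EuclideanSpace ℝ (Fin n))}
  {G : EuclideanSpace ℝ (Fin n) → Matrix (Fin n) (Fin n) ℝ} {y : EuclideanSpace ℝ (Fin n)}

/-- Contraction with the inverse matrix of the metric raises an index. -/
theorem sum_inv_mul (h : IsMetricOn B U)
    (hG : ∀ y ∈ U, ∀ i j, G y i j = B y (basisVec i) (basisVec j)) (hy : y ∈ U)
    (α : EuclideanSpace ℝ (Fin n) →L[ℝ] ℝ) (k : Fin n) :
    ∑ l, (G y)⁻¹ k l * α (basisVec l) = (B y).inverse α k := by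
  have hmul : ∀ x : EuclideanSpace ℝ (Fin n), G y *ᵥ x.ofLp = fun l => B y x (basisVec l) := by
    intro x
    ext l
    conv_rhs => rw [eq_sum_single x]
    simp only [map_sum, map_smul, sum_apply, smul_apply, smul_eq_mul, Matrix.mulVec, dotProduct]
    exact Finset.sum_congr rfl fun i _ => by rw [hG y hy, h.symm y hy, mul_comm]
  have hunit : IsUnit (G y) := by
    rw [← Matrix.mulVec_injective_iff_isUnit]
    intro a b hab
    have hab' : G y *ᵥ (WithLp.toLp 2 a).ofLp = G y *ᵥ (WithLp.toLp 2 b).ofLp := hab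
    rw [hmul, hmul] at hab'
    have h1 : WithLp.toLp 2 a = WithLp.toLp 2 b := by
      refine h.ext_left hy fun w => ?_
      rw [eq_sum_single w]
      simp only [map_sum, map_smul]
      exact Finset.sum_congr rfl fun i _ => by rw [congrFun hab' i]
    exact congrArg WithLp.ofLp h1
  have h2 : (fun l => α (basisVec l)) = G y *ᵥ ((B y).inverse α).ofLp := by
    rw [hmul, (h.isInvertible hy).self_apply_inverse]
  change ((G y)⁻¹ *ᵥ fun l => α (basisVec l)) k = _
  rw [h2, Matrix.mulVec_mulVec, Matrix.nonsing_inv_mul _ ((Matrix.isUnit_iff_isUnit_det _).1 hunit),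
    Matrix.one_mulVec]

theorem partialDeriv_eq (h : IsMetricOn B U)
    (hG : ∀ y ∈ U, ∀ i j, G y i j = B y (basisVec i) (basisVec j)) (hy : y ∈ U) (l i j : Fin n) :
    partialDeriv l (fun z => G z i j) y = fderiv ℝ B y (basisVec l) (basisVec i) (basisVec j) := by
  have h1 := (((h.differentiableAt hy).hasFDerivAt.clm_apply
    (hasFDerivAt_const (basisVec i) y)).clm_apply
    (hasFDerivAt_const (basisVec j) y)).congr_of_eventuallyEq
    (by filter_upwards [h.isOpen.mem_nhds hy] with z hz using hG z hz i j)
  rw [partialDeriv, h1.fderiv]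
  simp

theorem christoffel_eq (h : IsMetricOn B U)
    (hG : ∀ y ∈ U, ∀ i j, G y i j = B y (basisVec i) (basisVec j)) (hy : y ∈ U) (k i j : Fin n) :
    christoffel G k i j y = connection B y (basisVec i) (basisVec j) k := by
  rw [christoffel, connection_apply, ← h.sum_inv_mul hG hy, Finset.mul_sum]
  refine Finset.sum_congr rfl fun l _ => ?_
  rw [h.partialDeriv_eq hG hy, h.partialDeriv_eq hG hy, h.partialDeriv_eq hG hy, koszul_apply]
  ring

theorem partialDeriv_christoffel_eq (h : IsMetricOn B U)
    (hG : ∀ y ∈ U, ∀ i j, G y i j = B y (basisVec i) (basisVec j)) (hy : y ∈ U) (m k i j : Fin n) :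
    partialDeriv m (christoffel G k i j) y =
      fderiv ℝ (connection B) y (basisVec m) (basisVec i) (basisVec j) k := by
  have h1 := (((h.differentiableAt_connection hy).hasFDerivAt.clm_apply
    (hasFDerivAt_const (basisVec i) y)).clm_apply (hasFDerivAt_const (basisVec j) y))
  have h2 := HasFDerivAt.congr_of_eventuallyEq (f₁ := christoffel G k i j)
    ((EuclideanSpace.proj (𝕜 := ℝ) k).hasFDerivAt.comp y h1)
    (by filter_upwards [h.isOpen.mem_nhds hy] with z hz using h.christoffel_eq hG hz k i j)
  rw [partialDeriv, h2.fderiv]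
  simp

theorem ricciCoord_eq (h : IsMetricOn B U)
    (hG : ∀ y ∈ U, ∀ i j, G y i j = B y (basisVec i) (basisVec j)) (hy : y ∈ U) (j k : Fin n) :
    ricciCoord G j k y = ricci B y (basisVec j) (basisVec k) := by
  have hΓ : ∀ (a : EuclideanSpace ℝ (Fin n)) (b c i : Fin n),
      connection B y a (connection B y (basisVec b) (basisVec c)) i =
        ∑ m, connection B y a (basisVec m) i * connection B y (basisVec b) (basisVec c) m := by
    intro a b c i
    conv_lhs => rw [eq_sum_single (connection B y (basisVec b) (basisVec c))]
    simp only [map_sum, map_smul, WithLp.ofLp_sum, Finset.sum_apply, PiLp.smul_apply, smul_eq_mul]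
    exact Finset.sum_congr rfl fun m _ => mul_comm _ _
  rw [ricci_apply, trace_eq_sum_coord, ricciCoord, ← Finset.sum_add_distrib]
  refine Finset.sum_congr rfl fun i _ => ?_
  rw [curvature_apply, PiLp.sub_apply, PiLp.add_apply, PiLp.sub_apply, hΓ, hΓ,
    add_sub_assoc, ← Finset.sum_sub_distrib, h.partialDeriv_christoffel_eq hG hy,
    h.partialDeriv_christoffel_eq hG hy]
  simp only [h.christoffel_eq hG hy]

/-- The coordinate formula computes the trace of the Ricci curvature. -/
theorem scalarCoord_eq (h : IsMetricOn B U)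
    (hG : ∀ y ∈ U, ∀ i j, G y i j = B y (basisVec i) (basisVec j)) (hy : y ∈ U) :
    scalarCoord G y = scalar B y := by
  rw [scalar, trace_eq_sum_coord, scalarCoord]
  refine Finset.sum_congr rfl fun j _ => ?_
  simp only [h.ricciCoord_eq hG hy]
  exact h.sum_inv_mul hG hy (LinearMap.toContinuousLinearMap (ricci B y (basisVec j))) j

end IsMetricOn

end Euclidean

/-! ### Scalar curvature on a manifold -/

section Charts

variable {n : ℕ} {M : Type*} [TopologicalSpace M]
  [ChartedSpace (EuclideanSpace ℝ (Fin n)) M] [IsManifold (𝓡 n) ∞ M]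

/-- The metric `g` in the chart `e`, as a field of bilinear forms on `ℝⁿ`. -/
def chartMetric (g : Metric n M) (e : OpenPartialHomeomorph M (EuclideanSpace ℝ (Fin n)))
    (y : EuclideanSpace ℝ (Fin n)) :
    EuclideanSpace ℝ (Fin n) →L[ℝ] EuclideanSpace ℝ (Fin n) →L[ℝ] ℝ :=
  ContinuousLinearMap.bilinearComp (E := EuclideanSpace ℝ (Fin n)) (F := EuclideanSpace ℝ (Fin n))
    (g.inner (e.symm y)) (mfderiv (𝓡 n) (𝓡 n) e.symm y) (mfderiv (𝓡 n) (𝓡 n) e.symm y)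

theorem chartMetric_apply (g : Metric n M)
    (e : OpenPartialHomeomorph M (EuclideanSpace ℝ (Fin n))) (y u v : EuclideanSpace ℝ (Fin n)) :
    chartMetric g e y u v = g.inner (e.symm y) (mfderiv (𝓡 n) (𝓡 n) e.symm y u)
      (mfderiv (𝓡 n) (𝓡 n) e.symm y v) := rfl

theorem metricCoord_apply (g : Metric n M)
    (e : OpenPartialHomeomorph M (EuclideanSpace ℝ (Fin n))) (y : EuclideanSpace ℝ (Fin n))
    (i j : Fin n) : metricCoord g e y i j = chartMetric g e y (basisVec i) (basisVec j) := rfl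

variable {e e' : OpenPartialHomeomorph M (EuclideanSpace ℝ (Fin n))}

/-- The image of a constant vector field under the inverse of a chart is smooth. -/
theorem contMDiffOn_mfderiv_symm (he : e ∈ atlas (EuclideanSpace ℝ (Fin n)) M)
    (u : EuclideanSpace ℝ (Fin n)) :
    ContMDiffOn (𝓡 n) ((𝓡 n).prod (𝓡 n)) ∞
      (fun y => (TotalSpace.mk' (EuclideanSpace ℝ (Fin n)) (e.symm y)
        (mfderiv (𝓡 n) (𝓡 n) e.symm y u) : TangentBundle (𝓡 n) M)) e.target := by
  have h1 : ContMDiffOn (𝓡 n) (𝓡 n) ∞ e.symm e.target :=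
    contMDiffOn_symm_of_mem_maximalAtlas (IsManifold.subset_maximalAtlas he)
  have h2 := h1.contMDiffOn_tangentMapWithin (m := ∞) (by simp) e.open_target.uniqueMDiffOn
  have h3 : ContMDiff (𝓡 n) ((𝓡 n).prod (𝓡 n)) ∞
      (fun y => (⟨y, u⟩ : TangentBundle (𝓡 n) (EuclideanSpace ℝ (Fin n)))) := by
    exact contMDiff_vectorSpace_iff_contDiff.2 contDiff_const
  refine (h2.comp h3.contMDiffOn (fun y hy => hy)).congr fun y hy => ?_
  simp only [Function.comp, tangentMapWithin]
  rw [mfderivWithin_of_isOpen e.open_target hy]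

theorem isMetricOn_chartMetric (g : Metric n M) (he : e ∈ atlas (EuclideanSpace ℝ (Fin n)) M) :
    IsMetricOn (chartMetric g e) e.target where
  isOpen := e.open_target
  contDiffOn := by
    refine contDiffOn_clm_apply.2 fun u => contDiffOn_clm_apply.2 fun v => ?_
    rw [← contMDiffOn_iff_contDiffOn]
    intro y hy
    have hsymm : ContMDiffOn (𝓡 n) (𝓡 n) ∞ e.symm e.target :=
      contMDiffOn_symm_of_mem_maximalAtlas (IsManifold.subset_maximalAtlas he)
    have h1 : ContMDiffWithinAt (𝓡 n) ((𝓡 n).prod 𝓘(ℝ, ℝ)) ∞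
        (fun y => TotalSpace.mk' ℝ (E := Bundle.Trivial M ℝ) (e.symm y)
          (g.inner (e.symm y) (mfderiv (𝓡 n) (𝓡 n) e.symm y u)
            (mfderiv (𝓡 n) (𝓡 n) e.symm y v))) e.target y := by
      apply ContMDiffWithinAt.clm_bundle_apply₂ (F₁ := EuclideanSpace ℝ (Fin n))
        (F₂ := EuclideanSpace ℝ (Fin n))
      · exact ContMDiffAt.comp_contMDiffWithinAt y g.contMDiff.contMDiffAt (hsymm y hy)
      · exact contMDiffOn_mfderiv_symm he u y hy
      · exact contMDiffOn_mfderiv_symm he v y hy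
    simp only [contMDiffWithinAt_totalSpace] at h1
    exact h1.2
  symm y _ u v := by
    rw [chartMetric_apply, chartMetric_apply]
    exact g.symm (e.symm y) (mfderiv (𝓡 n) (𝓡 n) e.symm y u) (mfderiv (𝓡 n) (𝓡 n) e.symm y v)
  pos y hy u hu := by
    refine g.pos _ _ fun h0 => hu ?_
    have hinj : Function.Injective (mfderiv (𝓡 n) (𝓡 n) e.symm y) :=
      (mdifferentiable_of_mem_atlas (I := 𝓡 n) he).symm.mfderiv_injective hy
    rw [injective_iff_map_eq_zero] at hinj
    exact hinj u h0

/-- Changes of charts are isometries between the coordinate expressions of a metric. -/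
theorem isLocalIsometryOn_chart (g : Metric n M) (he : e ∈ atlas (EuclideanSpace ℝ (Fin n)) M)
    (he' : e' ∈ atlas (EuclideanSpace ℝ (Fin n)) M) :
    IsLocalIsometryOn (e' ∘ e.symm) (chartMetric g e) (e.target ∩ e.symm ⁻¹' e'.source)
      (chartMetric g e') e'.target := by
  have hopen : IsOpen (e.target ∩ e.symm ⁻¹' e'.source) :=
    e.isOpen_inter_preimage_symm e'.open_source
  have hm := isMetricOn_chartMetric g he
  have hsymm : ContMDiffOn (𝓡 n) (𝓡 n) ∞ e.symm e.target :=
    contMDiffOn_symm_of_mem_maximalAtlas (IsManifold.subset_maximalAtlas he)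
  have hchart : ContMDiffOn (𝓡 n) (𝓡 n) ∞ e' e'.source :=
    contMDiffOn_of_mem_maximalAtlas (IsManifold.subset_maximalAtlas he')
  have hφ : ContMDiffOn (𝓡 n) (𝓡 n) ∞ (e' ∘ e.symm) (e.target ∩ e.symm ⁻¹' e'.source) :=
    hchart.comp (hsymm.mono inter_subset_left) fun y hy => hy.2
  have hmaps : MapsTo (e' ∘ e.symm) (e.target ∩ e.symm ⁻¹' e'.source) e'.target :=
    fun y hy => e'.map_source hy.2
  refine ⟨⟨hopen, hm.contDiffOn.mono inter_subset_left, fun y hy => hm.symm y hy.1,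
    fun y hy => hm.pos y hy.1⟩, isMetricOn_chartMetric g he', contMDiffOn_iff_contDiffOn.1 hφ,
    hmaps, fun y hy u v => ?_⟩
  have hd : MDifferentiableAt (𝓡 n) (𝓡 n) (e' ∘ e.symm) y :=
    ((hφ y hy).contMDiffAt (hopen.mem_nhds hy)).mdifferentiableAt (by simp)
  have hd' : MDifferentiableAt (𝓡 n) (𝓡 n) e'.symm ((e' ∘ e.symm) y) :=
    mdifferentiableAt_atlas_symm he' (hmaps hy)
  have hev : e.symm =ᶠ[𝓝 y] e'.symm ∘ (e' ∘ e.symm) := by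
    filter_upwards [hopen.mem_nhds hy] with z hz using (e'.left_inv hz.2).symm
  have hcomp : ∀ w : EuclideanSpace ℝ (Fin n), mfderiv (𝓡 n) (𝓡 n) e.symm y w =
      mfderiv (𝓡 n) (𝓡 n) e'.symm ((e' ∘ e.symm) y) (fderiv ℝ (e' ∘ e.symm) y w) := by
    intro w
    have h1 := (hd'.hasMFDerivAt.comp y hd.hasMFDerivAt).congr_of_eventuallyEq hev
    rw [h1.mfderiv, mfderiv_eq_fderiv]
    rfl
  -- The base points `e.symm y` and `e'.symm (e' (e.symm y))` are equal only propositionally.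
  have hpt : ∀ (p q : M), p = q → ∀ a b : EuclideanSpace ℝ (Fin n),
      g.inner p (a : TangentSpace (𝓡 n) p) (b : TangentSpace (𝓡 n) p) =
        g.inner q (a : TangentSpace (𝓡 n) q) (b : TangentSpace (𝓡 n) q) := by
    rintro p q rfl a b
    rfl
  rw [chartMetric_apply, chartMetric_apply, hcomp, hcomp]
  exact hpt _ _ (e'.left_inv hy.2).symm _ _

/-- The scalar curvature may be computed in any chart. -/
theorem scalarCurvature_eq (g : Metric n M) (he : e ∈ atlas (EuclideanSpace ℝ (Fin n)) M) {x : M}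
    (hx : x ∈ e.source) : scalarCurvature g x = scalar (chartMetric g e) (e x) := by
  set c := chartAt (EuclideanSpace ℝ (Fin n)) x with hc
  have hcx : x ∈ c.source := mem_chart_source _ x
  have hc' : c ∈ atlas (EuclideanSpace ℝ (Fin n)) M := chart_mem_atlas _ x
  have hinv : c.symm (c x) = x := c.left_inv hcx
  rw [scalarCurvature, ← hc, (isMetricOn_chartMetric g hc').scalarCoord_eq
    (fun y _ i j => metricCoord_apply g c y i j) (c.map_source hcx),
    (isLocalIsometryOn_chart g hc' he).scalar_eq ⟨c.map_source hcx, by simpa [hinv] using hx⟩,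
    Function.comp_apply, hinv]

theorem contMDiff_scalarCurvature (g : Metric n M) :
    ContMDiff (𝓡 n) 𝓘(ℝ, ℝ) ∞ (scalarCurvature g) := by
  intro x
  set c := chartAt (EuclideanSpace ℝ (Fin n)) x
  have hc : c ∈ atlas (EuclideanSpace ℝ (Fin n)) M := chart_mem_atlas _ x
  have hx : c.source ∈ 𝓝 x := c.open_source.mem_nhds (mem_chart_source _ x)
  have h1 : ContMDiffOn (𝓡 n) (𝓡 n) ∞ c c.source := contMDiffOn_chart
  have h2 : ContMDiffOn (𝓡 n) 𝓘(ℝ, ℝ) ∞ (scalar (chartMetric g c)) c.target :=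
    (isMetricOn_chartMetric g hc).contDiffOn_scalar.contMDiffOn
  refine ((h2.comp h1 fun y hy => c.map_source hy).contMDiffAt hx).congr_of_eventuallyEq ?_
  filter_upwards [hx] with y hy using scalarCurvature_eq g hc hy

/-- The conformal metric `e^{2f} g`. -/
def conformalMetric (g : Metric n M) (f : M → ℝ) (hf : ContMDiff (𝓡 n) 𝓘(ℝ, ℝ) ∞ f) :
    Metric n M where
  inner x := Real.exp (2 * f x) • g.inner x
  symm x v w := by
    change Real.exp (2 * f x) * g.inner x v w = Real.exp (2 * f x) * g.inner x w v
    rw [g.symm]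
  pos x v hv := mul_pos (Real.exp_pos _) (g.pos x v hv)
  isVonNBounded x := by
    -- The unit ball of `e^{2f} g` is the unit ball of `g` scaled by `e^{-f}`.
    refine ((g.isVonNBounded x).image
      (Real.exp (-f x) • ContinuousLinearMap.id ℝ (TangentSpace (𝓡 n) x))).subset ?_
    intro v hv
    have hv' : Real.exp (2 * f x) * g.inner x v v < 1 := hv
    refine ⟨Real.exp (f x) • v, ?_, ?_⟩
    · have : g.inner x (Real.exp (f x) • v) (Real.exp (f x) • v) =
          Real.exp (2 * f x) * g.inner x v v := by
        rw [map_smul, map_smul]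
        change Real.exp (f x) * (Real.exp (f x) * g.inner x v v) = _
        rw [← mul_assoc, ← Real.exp_add, two_mul]
      exact this.trans_lt hv'
    · change Real.exp (-f x) • Real.exp (f x) • v = v
      rw [smul_smul, ← Real.exp_add, neg_add_cancel, Real.exp_zero, one_smul]
  contMDiff := by
    have h2 : ContMDiff (𝓡 n) 𝓘(ℝ, ℝ) ∞ (fun x => Real.exp (2 * f x)) :=
      (Real.contDiff_exp.comp (contDiff_const.mul contDiff_id) :
        ContDiff ℝ ∞ (fun t : ℝ => Real.exp (2 * t))).contMDiff.comp hf
    exact h2.smul_section g.contMDiff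

theorem conformalMetric_inner (g : Metric n M) (f : M → ℝ) (hf : ContMDiff (𝓡 n) 𝓘(ℝ, ℝ) ∞ f)
    (x : M) (v w : TangentSpace (𝓡 n) x) :
    (conformalMetric g f hf).inner x v w = Real.exp (2 * f x) * g.inner x v w := rfl

theorem isConformalChange_conformalMetric (g : Metric n M) (f : M → ℝ)
    (hf : ContMDiff (𝓡 n) 𝓘(ℝ, ℝ) ∞ f) : IsConformalChange g (conformalMetric g f hf) :=
  ⟨f, hf, conformalMetric_inner g f hf⟩

theorem chartMetric_conformalMetric (g : Metric n M) (f : M → ℝ)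
    (hf : ContMDiff (𝓡 n) 𝓘(ℝ, ℝ) ∞ f) (e : OpenPartialHomeomorph M (EuclideanSpace ℝ (Fin n)))
    (y : EuclideanSpace ℝ (Fin n)) :
    chartMetric (conformalMetric g f hf) e y =
      Real.exp (2 * (f ∘ e.symm) y) • chartMetric g e y := rfl

/-- A smooth function which is a prescribed multiple of the squared coordinate distance to `x`
near `x`. -/
theorem exists_contMDiff_eventuallyEq_sq [T2Space M] (x : M) (a : ℝ) :
    ∃ f : M → ℝ, ContMDiff (𝓡 n) 𝓘(ℝ, ℝ) ∞ f ∧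
      f ∘ (chartAt (EuclideanSpace ℝ (Fin n)) x).symm
        =ᶠ[𝓝 (chartAt (EuclideanSpace ℝ (Fin n)) x x)]
          fun y => a * ‖y - chartAt (EuclideanSpace ℝ (Fin n)) x x‖ ^ 2 := by
  set c := chartAt (EuclideanSpace ℝ (Fin n)) x
  have hcx : x ∈ c.source := mem_chart_source _ x
  let b : SmoothBumpFunction (𝓡 n) x := Classical.arbitrary _
  have hc : ContMDiffOn (𝓡 n) (𝓡 n) ∞ c c.source := contMDiffOn_chart
  have hq : ContDiff ℝ ∞ (fun y : EuclideanSpace ℝ (Fin n) => a * ‖y - c x‖ ^ 2) :=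
    contDiff_const.mul ((contDiff_id.sub contDiff_const).norm_sq ℝ)
  refine ⟨fun z => b z • (a * ‖c z - c x‖ ^ 2),
    b.contMDiff_smul (hq.contMDiff.comp_contMDiffOn hc), ?_⟩
  have hcont : Tendsto c.symm (𝓝 (c x)) (𝓝 x) := by
    have h := c.symm.continuousAt (x := c x) (c.map_source hcx)
    rwa [ContinuousAt, c.left_inv hcx] at h
  filter_upwards [hcont.eventually b.eventuallyEq_one,
    c.open_target.mem_nhds (c.map_source hcx)] with y hy hyt
  simp [hy, c.right_inv hyt]

end Charts

section Quadratic

variable {E : Type*} [NormedAddCommGroup E] [InnerProductSpace ℝ E] {F : E → ℝ} {p : E} {a : ℝ}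

theorem fderiv_const_mul_norm_sq (a : ℝ) (p : E) :
    fderiv ℝ (fun y => a * ‖y - p‖ ^ 2) = fun y => (2 * a) • innerSL ℝ (y - p) := by
  ext1 y
  have h := (((hasFDerivAt_id (𝕜 := ℝ) y).sub_const p).norm_sq).const_mul a
  refine h.fderiv.trans ?_
  ext v
  simp
  ring

theorem fderiv_eq_zero_of_eventuallyEq_sq (h : F =ᶠ[𝓝 p] fun y => a * ‖y - p‖ ^ 2) :
    fderiv ℝ F p = 0 := by
  rw [h.fderiv_eq, fderiv_const_mul_norm_sq]
  simp

theorem fderiv_fderiv_of_eventuallyEq_sq (h : F =ᶠ[𝓝 p] fun y => a * ‖y - p‖ ^ 2) :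
    fderiv ℝ (fderiv ℝ F) p = (2 * a) • innerSL ℝ := by
  rw [h.fderiv.fderiv_eq, fderiv_const_mul_norm_sq]
  have h1 : HasFDerivAt (fun y : E => y - p) (ContinuousLinearMap.id ℝ E) p :=
    (hasFDerivAt_id p).sub_const p
  exact (((innerSL ℝ).hasFDerivAt.comp p h1).const_smul (2 * a)).fderiv

end Quadratic

variable {n : ℕ} {M : Type*} [TopologicalSpace M]
  [ChartedSpace (EuclideanSpace ℝ (Fin n)) M] [IsManifold (𝓡 n) ∞ M]

/-- In dimension at least two, the scalar curvature at a given point can be made positive by a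
conformal change of the metric. -/
theorem exists_conformal_scalarCurvature_pos [T2Space M] (hn : 2 ≤ n) (g : Metric n M) (x : M) :
    ∃ g' : Metric n M, IsConformalChange g g' ∧ 0 < scalarCurvature g' x := by
  set c := chartAt (EuclideanSpace ℝ (Fin n)) x with hcdef
  have hc : c ∈ atlas (EuclideanSpace ℝ (Fin n)) M := chart_mem_atlas _ x
  have hcx : x ∈ c.source := mem_chart_source _ x
  have hp : c x ∈ c.target := c.map_source hcx
  have hg := isMetricOn_chartMetric g hc
  have : Nonempty (Fin n) := ⟨⟨0, by omega⟩⟩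
  set t := LinearMap.trace ℝ (EuclideanSpace ℝ (Fin n))
    ((chartMetric g c (c x)).inverse ∘L innerSL ℝ).toLinearMap with ht
  have htpos : 0 < t := trace_inverse_inner_pos (hg.pos _ hp)
  have hn' : (0 : ℝ) < n - 1 := by
    have : (2 : ℝ) ≤ n := by exact_mod_cast hn
    linarith
  set S := scalar (chartMetric g c) (c x)
  -- The factor is chosen such that the conformal metric has scalar curvature `1` at `x`.
  obtain ⟨f, hf, hfq⟩ := exists_contMDiff_eventuallyEq_sq (n := n) x ((S - 1) / (4 * (n - 1) * t))
  refine ⟨conformalMetric g f hf, isConformalChange_conformalMetric g f hf, ?_⟩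
  have hF : ContDiffOn ℝ ∞ (f ∘ c.symm) c.target :=
    contMDiffOn_iff_contDiffOn.1 (hf.comp_contMDiffOn contMDiffOn_chart_symm)
  have key := hg.scalar_conformal hF
    (fun y _ => chartMetric_conformalMetric g f hf c y) hp (fderiv_eq_zero_of_eventuallyEq_sq hfq)
  have hval : (f ∘ c.symm) (c x) = 0 := by rw [hfq.eq_of_nhds]; simp
  have hhess : LinearMap.trace ℝ (EuclideanSpace ℝ (Fin n))
      (hessian (chartMetric g c) (f ∘ c.symm) (c x)).toLinearMap =
        2 * ((S - 1) / (4 * (n - 1) * t)) * t := by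
    rw [hessian, fderiv_fderiv_of_eventuallyEq_sq hfq, ContinuousLinearMap.comp_smul,
      ContinuousLinearMap.toLinearMap_smul, map_smul, smul_eq_mul]
  rw [hval, hhess, finrank_euclideanSpace_fin, mul_zero, Real.exp_zero, one_mul] at key
  rw [scalarCurvature_eq _ hc hcx, key]
  have : S - 2 * ((n : ℝ) - 1) * (2 * ((S - 1) / (4 * (n - 1) * t)) * t) = 1 := by
    field_simp
    ring
  rw [this]
  exact one_pos

end RiemannianScalar

end

theorem mainTheorem6 {n : ℕ} (hn : 3 ≤ n) {M : Type*} [TopologicalSpace M] [T2Space M]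
    [CompactSpace M] [Nonempty M] [ChartedSpace (EuclideanSpace ℝ (Fin n)) M]
    [IsManifold (𝓡 n) ∞ M] (g : RiemannianScalar.Metric n M)
    (hS : ∀ x : M, RiemannianScalar.scalarCurvature g x ≤ 0) :
    ∃ H' : M → ℝ, ContMDiff (𝓡 n) 𝓘(ℝ, ℝ) ∞ H' ∧ (∃ x : M, 0 < H' x) ∧
      ∃ g' : RiemannianScalar.Metric n M, RiemannianScalar.IsConformalChange g g' ∧
        ∀ x : M, RiemannianScalar.scalarCurvature g' x = H' x := by
  obtain ⟨x⟩ := ‹Nonempty M›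
  obtain ⟨g', hg', hpos⟩ :=
    RiemannianScalar.exists_conformal_scalarCurvature_pos (by omega : 2 ≤ n) g x
  exact ⟨RiemannianScalar.scalarCurvature g', RiemannianScalar.contMDiff_scalarCurvature g',
    ⟨x, hpos⟩, g', hg', fun _ => rfl⟩
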